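/- Conventions. A simplicial complex $K$ "on a finite vertex set $I$ (without ghost vertices)" has exactly the elements of $I$ as vertices; $K\setminus\{i\}$ is its deletion (all faces not containing $i$), $K_J$ its restriction to $J\subseteq I$, $|K|$ its geometric realization, and $\Delta^{I}$ the full simplex on $I$. For a space $X$ without basepoint, $\Sigma X$ is the unreduced suspension of $X$ over $[-1,1]$, pointed by the cone point at $-1$; further suspensions are reduced, so for $n=|I|$ and a complex $K$ with vertices in $I$, $\Sigma^{n}|K|$ is the quotient of $[-1,1]^{n-1}\times\Sigma|K|$ that collapses $\partial[-1,1]^{n-1}\times\Sigma|K|\,\cup\,[-1,1]^{n-1}\times\{\ast\}$ to the basepoint. Extractible. A complex $K$ on $I$ is *extractible* if either $K\setminus\{i\}$ is the full simplex on $I\setminus\{i\}$ for some $i\in I$, or else (recursively) $K\setminus\{i\}$ is extractible on $I\setminus\{i\}$ for every $i\in I$ and the wedge of inclusions $\bigvee_{i\in I}\Sigma|K\setminus\{i\}|\to\Sigma|K|$ has a right homotopy inverse (pointed maps and pointed homotopies). Here the full simplex on the empty set is the complex without vertices, so a single vertex is extractible. Coherently homotopy Golod. Let $L$ be a complex on $I$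 without ghost vertices and $K\subseteq L$ a subcomplex, $n=|I|$. The pair $(L,K)$ is *coherently homotopy Golod* on $I$ if $L$ is a single vertex, or $K=\emptyset$, or (recursively) $(L\setminus\{i\},K\setminus\{i\})$ is coherently homotopy Golod on $I\setminus\{i\}$ for every $i\in I$ and, for some ordering $v_1,\dots,v_n$ of $I$, there is a continuous basepoint-preserving map $\Psi\colon\Sigma^n|K|\to\Sigma|\Delta^{I}|$ such that 1. $\Psi(0,\dots,0,x)=x$ for all $x\in\Sigma|K|\subseteq\Sigma|L|\subseteq\Sigma|\Delta^{I}|$; 2. for all $(t_1,\dots,t_{n-1})\in(-1,1)^{n-1}$ and $x\in\Sigma|K|$, one has $\Psi(t_1,\dots,t_{n-1},x)\in\Sigma|L_{I_1}\ast\cdots\ast L_{I_m}|\subseteq\Sigma|\Delta^{I}|$, where $I_1,\dots,I_m$ is the partition of $I$ into the level sets of the function $v_j\mapsto t_j$ $(j<n)$, $v_n\mapsto 0$. A complex $K$ on $I$ without ghost vertices is *coherently homotopy Golod* if the pair $(K,K)$ is. Statement. Let $K$ be a simplicial complex on a finite vertex set $I$ without ghost vertices. If $K$ is extractible, then $K$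 is coherently homotopy Golod. -/

import Mathlib

/-! ### Spaces: unreduced suspension, wedge -/

/-- The interval `D¹ = [-1, 1]`. -/
abbrev D1 : Type := Set.Icc (-1 : ℝ) 1

/-- The identifications `(-1, x) ∼ ∗₋₁` and `(1, x) ∼ ∗₁` on `(D¹ × X) ⊔ {∗₋₁, ∗₁}`; the point `∗₋₁`
is `Sum.inr false` and the point `∗₁` is `Sum.inr true`. -/
inductive UnreducedSuspension.Rel (X : Type*) : (D1 × X) ⊕ Bool → (D1 × X) ⊕ Bool → Prop
  | bot (t : D1) (x : X) (ht : (t : ℝ) = -1) : Rel X (Sum.inl (t, x)) (Sum.inr false)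
  | top (t : D1) (x : X) (ht : (t : ℝ) = 1) : Rel X (Sum.inl (t, x)) (Sum.inr true)

/-- The unreduced suspension `Σ X` of a space without basepoint. -/
def UnreducedSuspension (X : Type*) : Type _ := Quot (UnreducedSuspension.Rel X)

namespace UnreducedSuspension

instance (X : Type*) [TopologicalSpace X] : TopologicalSpace (UnreducedSuspension X) :=
  inferInstanceAs (TopologicalSpace (Quot (UnreducedSuspension.Rel X)))

/-- The basepoint `∗₋₁` of `Σ X`. -/
def base (X : Type*) : UnreducedSuspension X := Quot.mk _ (Sum.inr false)

/-- The map `Σ f : Σ X → Σ Y`, `(t, x) ↦ (t, f x)`. -/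
def map {X Y : Type*} [TopologicalSpace X] [TopologicalSpace Y] (f : C(X, Y)) :
    C(UnreducedSuspension X, UnreducedSuspension Y) where
  toFun := Quot.map (Sum.map (Prod.map id f) id) (by
    rintro _ _ (⟨t, x, ht⟩ | ⟨t, x, ht⟩)
    · exact Rel.bot t (f x) ht
    · exact Rel.top t (f x) ht)
  continuous_toFun := by
    refine continuous_quot_lift _ (continuous_quot_mk.comp ?_)
    exact (continuous_id.prodMap f.continuous).sumMap continuous_id

theorem map_base {X Y : Type*} [TopologicalSpace X] [TopologicalSpace Y] (f : C(X, Y)) :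
    map f (base X) = base Y := rfl

end UnreducedSuspension

/-- All the basepoints `pt i` are identified with one additional point (so that the wedge of the
empty family is a point). -/
inductive WedgeSum.Rel {ι : Type*} {X : ι → Type*} (pt : ∀ i, X i) :
    (Σ i, X i) ⊕ Unit → (Σ i, X i) ⊕ Unit → Prop
  | glue (i : ι) : Rel pt (Sum.inl ⟨i, pt i⟩) (Sum.inr ())

/-- The wedge sum of the pointed spaces `(X i, pt i)`. -/
def WedgeSum {ι : Type*} {X : ι → Type*} (pt : ∀ i, X i) : Type _ := Quot (WedgeSum.Rel pt)

namespace WedgeSum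

instance {ι : Type*} {X : ι → Type*} [∀ i, TopologicalSpace (X i)] (pt : ∀ i, X i) :
    TopologicalSpace (WedgeSum pt) :=
  inferInstanceAs (TopologicalSpace (Quot (WedgeSum.Rel pt)))

/-- The basepoint of the wedge sum. -/
def base {ι : Type*} {X : ι → Type*} (pt : ∀ i, X i) : WedgeSum pt := Quot.mk _ (Sum.inr ())

/-- The map `⋁ X i → Y` determined by pointed maps `f i : X i → Y`. -/
def desc {ι : Type*} {X : ι → Type*} [∀ i, TopologicalSpace (X i)] {pt : ∀ i, X i}
    {Y : Type*} [TopologicalSpace Y] (y : Y) (f : ∀ i, C(X i, Y)) (hf : ∀ i, f i (pt i) = y) :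
    C(WedgeSum pt, Y) where
  toFun := Quot.lift (Sum.elim (fun p => f p.1 p.2) fun _ => y) (by
    rintro _ _ ⟨i⟩
    exact hf i)
  continuous_toFun := by
    refine continuous_quot_lift _ ?_
    exact (continuous_sigma fun i => (f i).continuous).sumElim continuous_const

end WedgeSum

/-! ### Simplicial complexes

A simplicial complex with vertices in `V` is a `PreAbstractSimplicialComplex V`; only the nonempty
faces are recorded, so that `⊥` is the complex `∅` without vertices. -/

namespace PreAbstractSimplicialComplex

variable {V : Type*}

/-- `K` is a complex on the vertex set `I` without ghost vertices: its vertices are exactly the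
elements of `I`. -/
def HasVertexSet (K : PreAbstractSimplicialComplex V) (I : Finset V) : Prop :=
  ∀ i : V, {i} ∈ K.faces ↔ i ∈ I

/-- The full simplex `Δ` on the vertex set `I` (it is `∅` if `I` is empty). -/
def fullSimplex (I : Finset V) : PreAbstractSimplicialComplex V where
  faces := {σ | σ.Nonempty ∧ σ ⊆ I}
  isRelLowerSet_faces := fun _ h => ⟨h.1, fun _ hb hne => ⟨hne, hb.trans h.2⟩⟩

/-- The deletion `K ∖ {i}`: all faces of `K` that do not contain `i`. -/
def deleteVertex (K : PreAbstractSimplicialComplex V) (i : V) : PreAbstractSimplicialComplex V where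
  faces := {σ | σ ∈ K.faces ∧ i ∉ σ}
  isRelLowerSet_faces := fun _ h => ⟨(K.isRelLowerSet_faces h.1).1, fun _ hb hne =>
    ⟨(K.isRelLowerSet_faces h.1).2 hb hne, fun hi => h.2 (hb hi)⟩⟩

/-- For pairwise disjoint vertex sets `I₁, …, I_m` (the elements of `P`) this is the join
`L_{I₁} ∗ ⋯ ∗ L_{I_m}` of the restrictions of `L` to these sets, as a subcomplex of the simplex on
`I₁ ∪ ⋯ ∪ I_m`: its faces are the nonempty sets `σ₁ ∪ ⋯ ∪ σ_m`, where each `σ_j ⊆ I_j` is a face of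
`L` or empty. The order of the factors plays no role. -/
def restrictJoin [DecidableEq V] (L : PreAbstractSimplicialComplex V) (P : Finset (Finset V)) :
    PreAbstractSimplicialComplex V where
  faces := {σ | σ.Nonempty ∧ σ ⊆ P.biUnion id ∧ ∀ J ∈ P, (σ ∩ J).Nonempty → σ ∩ J ∈ L.faces}
  isRelLowerSet_faces := fun _ h => ⟨h.1, fun _ hτ hne => ⟨hne, hτ.trans h.2.1, fun J hJ hJne =>
    (L.isRelLowerSet_faces (h.2.2 J hJ
      (hJne.mono (Finset.inter_subset_inter_right hτ)))).2
        (Finset.inter_subset_inter_right hτ) hJne⟩⟩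

/-- The geometric realization `|K|`, as a subspace of `ℝ^V` (barycentric coordinates). -/
def realization (K : PreAbstractSimplicialComplex V) : Set (V → ℝ) :=
  {x | (∀ i, 0 ≤ x i) ∧ ∃ σ ∈ K.faces, (∀ i, i ∉ σ → x i = 0) ∧ ∑ i ∈ σ, x i = 1}

theorem realization_mono {K L : PreAbstractSimplicialComplex V} (h : K ≤ L) :
    K.realization ⊆ L.realization :=
  fun _ hx => ⟨hx.1, hx.2.imp fun _ hσ => ⟨h hσ.1, hσ.2⟩⟩

/-- The suspended inclusion `Σ|K| → Σ|L|` of a subcomplex `K` of `L`. -/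
noncomputable def suspIncl {K L : PreAbstractSimplicialComplex V} (h : K ≤ L) :
    C(UnreducedSuspension K.realization, UnreducedSuspension L.realization) :=
  UnreducedSuspension.map ⟨Set.inclusion (realization_mono h), continuous_inclusion _⟩

theorem deleteVertex_le (K : PreAbstractSimplicialComplex V) (i : V) : K.deleteVertex i ≤ K :=
  fun _ h => h.1

theorem HasVertexSet.le_fullSimplex {K : PreAbstractSimplicialComplex V} {I : Finset V}
    (h : K.HasVertexSet I) : K ≤ fullSimplex I := fun _ hσ =>
  ⟨(K.isRelLowerSet_faces hσ).1, fun i hi => (h i).1 ((K.isRelLowerSet_faces hσ).2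
    (Finset.singleton_subset_iff.2 hi) (Finset.singleton_nonempty i))⟩

/-! ### Extractible complexes -/

/-- The wedge `⋁_{i ∈ I} Σ|K ∖ {i}|`. -/
abbrev DeletionWedge (K : PreAbstractSimplicialComplex V) (I : Finset V) : Type _ :=
  WedgeSum (fun i : I => UnreducedSuspension.base (K.deleteVertex (i : V)).realization)

/-- The wedge sum of inclusions `⋁_{i ∈ I} Σ|K ∖ {i}| → Σ|K|`. -/
noncomputable def deletionWedgeMap (K : PreAbstractSimplicialComplex V) (I : Finset V) :
    C(K.DeletionWedge I, UnreducedSuspension K.realization) :=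
  WedgeSum.desc (UnreducedSuspension.base _) (fun i : I => suspIncl (K.deleteVertex_le (i : V)))
    (fun _ => rfl)

/-- Extractible complexes `K` on the vertex set `I`. The right homotopy inverse is taken in the
category of pointed spaces. -/
inductive Extractible [DecidableEq V] : Finset V → PreAbstractSimplicialComplex V → Prop
  | simplex (I : Finset V) (K : PreAbstractSimplicialComplex V) (i : V) (hi : i ∈ I)
      (h : K.deleteVertex i = fullSimplex (I.erase i)) : Extractible I K
  | step (I : Finset V) (K : PreAbstractSimplicialComplex V)
      (hdel : ∀ i ∈ I, Extractible (I.erase i) (K.deleteVertex i))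
      (hs : ∃ s : C(UnreducedSuspension K.realization, K.DeletionWedge I),
        s (UnreducedSuspension.base _) = WedgeSum.base _ ∧
        ((K.deletionWedgeMap I).comp s).HomotopicRel (ContinuousMap.id _)
          {UnreducedSuspension.base _}) : Extractible I K

/-! ### Coherently homotopy Golod complexes -/

/-- The points of `[-1,1]^J × Σ|K|` that are collapsed in `Σ^{|J|} Σ|K|`: those with some
coordinate `t_j = ± 1`, or with the basepoint of `Σ|K|` as last entry. -/
def collapsed (J : Finset V) (K : PreAbstractSimplicialComplex V) :
    Set ((J → D1) × UnreducedSuspension K.realization) :=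
  {p | (∃ j, ((p.1 j : D1) : ℝ) = 1 ∨ ((p.1 j : D1) : ℝ) = -1) ∨
    p.2 = UnreducedSuspension.base _}

/-- The iterated suspension `Σ^{|J|} Σ|K| = ([-1,1]^J / ∂[-1,1]^J) ∧ Σ|K|`, that is, `Σ|K|` suspended
once (in the reduced sense) for each element of `J`. -/
def IterSusp (J : Finset V) (K : PreAbstractSimplicialComplex V) : Type _ :=
  Quot (fun p q : (J → D1) × UnreducedSuspension K.realization =>
    p ∈ collapsed J K ∧ q ∈ collapsed J K)

instance (J : Finset V) (K : PreAbstractSimplicialComplex V) : TopologicalSpace (IterSusp J K) :=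
  inferInstanceAs (TopologicalSpace (Quot _))

/-- The point `(t, x)` of `Σ^{|J|} Σ|K|`. -/
def IterSusp.mk {J : Finset V} {K : PreAbstractSimplicialComplex V} (t : J → D1)
    (x : UnreducedSuspension K.realization) : IterSusp J K := Quot.mk _ (t, x)

/-- The origin `0` of `[-1,1]^J`. -/
def cubeZero (J : Finset V) : J → D1 := fun _ => ⟨0, by norm_num⟩

/-- The basepoint of `Σ^{|J|} Σ|K|`. -/
def IterSusp.base (J : Finset V) (K : PreAbstractSimplicialComplex V) : IterSusp J K :=
  IterSusp.mk (cubeZero J) (UnreducedSuspension.base _)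

/-- The partition of `I` into the sets on which `s : V → ℝ` is constant. -/
noncomputable def levelSets [DecidableEq V] (I : Finset V) (s : V → ℝ) : Finset (Finset V) :=
  (I.image s).image fun c => I.filter fun i => s i = c

theorem restrictJoin_levelSets_le [DecidableEq V] (L : PreAbstractSimplicialComplex V)
    (I : Finset V) (s : V → ℝ) : L.restrictJoin (levelSets I s) ≤ fullSimplex I := by
  rintro σ ⟨hne, hsub, -⟩
  refine ⟨hne, fun i hi => ?_⟩
  obtain ⟨J, hJ, hiJ⟩ := Finset.mem_biUnion.1 (hsub hi)
  obtain ⟨c, -, rfl⟩ := Finset.mem_image.1 hJ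
  exact (Finset.mem_filter.1 hiJ).1

/-- The sequence `(t, 0)`: the parameters `t_j`, `j ∈ J`, together with the value `0` at the
exceptional vertex. -/
noncomputable def extendZero [DecidableEq V] {J : Finset V} (t : J → D1) : V → ℝ :=
  fun v => if h : v ∈ J then ((t ⟨v, h⟩ : D1) : ℝ) else 0

/-- `Ψ : Σ^n|K| → Σ|Δ^{n-1}|` is a pointed map as required in the definition of coherent homotopy
Golodness of the pair `(L, K)` on the vertex set `I` with `n` elements. The last vertex in the
chosen vertex ordering is `e`; each other vertex `i` has its own suspension parameter `t_i`. -/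
structure IsGolodMap [DecidableEq V] (I : Finset V) (L K : PreAbstractSimplicialComplex V)
    (hK : K ≤ fullSimplex I) (e : V)
    (Ψ : C(IterSusp (I.erase e) K, UnreducedSuspension (fullSimplex I).realization)) : Prop where
  map_base : Ψ (IterSusp.base _ K) = UnreducedSuspension.base _
  at_zero : ∀ x : UnreducedSuspension K.realization,
    Ψ (IterSusp.mk (cubeZero _) x) = suspIncl hK x
  mem_join : ∀ t : {v // v ∈ I.erase e} → D1,
    (∀ j, ((t j : D1) : ℝ) ≠ 1 ∧ ((t j : D1) : ℝ) ≠ -1) →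
    ∀ x : UnreducedSuspension K.realization,
      Ψ (IterSusp.mk t x) ∈
        Set.range (suspIncl (restrictJoin_levelSets_le L I (extendZero t)))

/-- Coherent homotopy Golodness of the pair `(L, K)` on the vertex set `I`, where `K` is a subcomplex
of `L` and `L` has no ghost vertices. -/
inductive CoherentlyHomotopyGolodPair [DecidableEq V] :
    Finset V → PreAbstractSimplicialComplex V → PreAbstractSimplicialComplex V → Prop
  | vertex (v : V) (L K : PreAbstractSimplicialComplex V) (hL : L.HasVertexSet {v}) (hKL : K ≤ L) :
      CoherentlyHomotopyGolodPair {v} L K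
  | empty (I : Finset V) (L : PreAbstractSimplicialComplex V) (hL : L.HasVertexSet I) :
      CoherentlyHomotopyGolodPair I L ⊥
  | step (I : Finset V) (L K : PreAbstractSimplicialComplex V) (hL : L.HasVertexSet I) (hKL : K ≤ L)
      (hdel : ∀ i ∈ I,
        CoherentlyHomotopyGolodPair (I.erase i) (L.deleteVertex i) (K.deleteVertex i))
      (hΨ : ∃ e ∈ I,
        ∃ Ψ : C(IterSusp (I.erase e) K, UnreducedSuspension (fullSimplex I).realization),
          IsGolodMap I L K (hKL.trans hL.le_fullSimplex) e Ψ) :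
      CoherentlyHomotopyGolodPair I L K

/-- Coherent homotopy Golodness of a complex `K` on the vertex set `I`: the case `L = K`. -/
def CoherentlyHomotopyGolod [DecidableEq V] (I : Finset V) (K : PreAbstractSimplicialComplex V) :
    Prop :=
  CoherentlyHomotopyGolodPair I K K

end PreAbstractSimplicialComplex

/-!
The Golod maps are obtained from null-homotopies of `Σ|K|` in `Σ|Δ^I|` in which no vertex plays a
special role (`IsCoherentContraction`). Such a null-homotopy is controlled by one real number `τ_i`
for each vertex `i ∈ I`: it is the inclusion if all `τ_i` agree, it is constant if two of them are
at distance at least `1`, and it lands in the suspension of the join of the restrictions of `K` to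
the level sets of `τ`. Putting `τ_e = 0` and `τ_j = t_j` for `j ≠ e` gives a Golod map for every
choice of the last vertex `e`; on the boundary of the cube some `τ_j` is at distance `1` from
`τ_e`, so the map descends to the iterated suspension.

The basic move is `conePush`: contract `|Δ^I|` linearly to a vertex `v` and then `Σ{v}` to the
basepoint. It may be applied for a time depending on `τ` whenever the join contains the cone with
apex `v` over the part in question.

* If `K ∖ {i}` is a full simplex, then membership in the join only depends on the part of a face in
  the level set of `i`. So one may push towards each `j ≠ i` in turn, for a time proportional to
  `|τ_j - τ_i|` (`CoherentlyContractible.of_simplex`).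
* If the wedge of the `Σ|K ∖ {i}|` has a homotopy section `s` over `Σ|K|`, use the homotopy from the
  identity to the inclusion after `s` while the `τ_i` are close to each other. Afterwards, the
  contraction of `Σ|K ∖ {i}|` known by induction is applied on the `i`-th wedge summand. It does not
  depend on `τ_i`; but if the other `τ_j` stay close together, then `τ_i` is far from all of them,
  the vertex `i` is a level set of its own, and one may push towards `i`
  (`exists_deletionWedge_contraction`, `CoherentlyContractible.of_section`).

Finally, all deletions of an extractible complex on at least two vertices are again extractible
(`Extractible.deleteVertex`), which provides the recursive part of coherent homotopy Golodness.
-/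

/-! ### Maps out of suspensions and wedges -/

namespace UnreducedSuspension

/-- The map `Σ X → Y` determined by a map on the cylinder that is constant on each end. The values
at the cone points are separate data because `X` may be empty. -/
def desc {X Y : Type*} [TopologicalSpace X] [TopologicalSpace Y] (f : C(D1 × X, Y)) (b t : Y)
    (hb : ∀ (s : D1) (x : X), (s : ℝ) = -1 → f (s, x) = b)
    (ht : ∀ (s : D1) (x : X), (s : ℝ) = 1 → f (s, x) = t) : C(UnreducedSuspension X, Y) where
  toFun := Quot.lift (Sum.elim f fun c => bif c then t else b) (by
    rintro _ _ (⟨s, x, hs⟩ | ⟨s, x, hs⟩)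
    · exact hb s x hs
    · exact ht s x hs)
  continuous_toFun := continuous_quot_lift _
    (f.continuous.sumElim continuous_of_discreteTopology)

/-- The point `(s, x)` of the suspension. -/
def mk {X : Type*} (s : D1) (x : X) : UnreducedSuspension X := Quot.mk _ (Sum.inl (s, x))

/-- The cone point `∗₁` of the suspension. -/
def apex (X : Type*) : UnreducedSuspension X := Quot.mk _ (Sum.inr true)

theorem continuous_mk {X : Type*} [TopologicalSpace X] :
    Continuous fun p : D1 × X => mk p.1 p.2 :=
  continuous_quot_mk.comp continuous_inl

theorem mk_eq_base {X : Type*} {s : D1} (hs : (s : ℝ) = -1) (x : X) : mk s x = base X :=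
  Quot.sound (Rel.bot s x hs)

theorem mk_eq_apex {X : Type*} {s : D1} (hs : (s : ℝ) = 1) (x : X) : mk s x = apex X :=
  Quot.sound (Rel.top s x hs)

theorem ind {X : Type*} {p : UnreducedSuspension X → Prop} (hb : p (base X)) (ht : p (apex X))
    (hmk : ∀ s x, p (mk s x)) (x : UnreducedSuspension X) : p x := by
  obtain ⟨(⟨s, x⟩ | (_ | _)), rfl⟩ := Quot.exists_rep x
  exacts [hmk s x, hb, ht]

/-- Moving a suspension coordinate towards `-1`: `s` stays fixed while `d ≤ 1` and is then lowered
at unit speed, so that it has reached `-1` once `d ≥ 3`. -/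
noncomputable def slide (d : ℝ) (s : D1) : D1 :=
  Set.projIcc (-1) 1 (by norm_num) ((s : ℝ) - max 0 (d - 1))

theorem continuous_slide : Continuous fun p : ℝ × D1 => slide p.1 p.2 :=
  continuous_projIcc.comp (by fun_prop)

theorem slide_of_le {d : ℝ} (hd : d ≤ 1) (s : D1) : slide d s = s := by
  rw [slide, max_eq_left (by linarith), sub_zero, Set.projIcc_val]

theorem slide_neg_one (d : ℝ) {s : D1} (hs : (s : ℝ) = -1) : (slide d s : ℝ) = -1 := by
  rw [slide, Set.projIcc_of_le_left]
  rw [hs]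
  linarith [le_max_left 0 (d - 1)]

theorem slide_of_ge {d : ℝ} (hd : 3 ≤ d) (s : D1) : (slide d s : ℝ) = -1 := by
  rw [slide, Set.projIcc_of_le_left]
  linarith [le_max_right 0 (d - 1), s.2.2]

end UnreducedSuspension

theorem WedgeSum.ind {ι : Type*} {X : ι → Type*} {pt : ∀ i, X i} {p : WedgeSum pt → Prop}
    (hb : p (WedgeSum.base pt)) (h : ∀ i x, p (Quot.mk _ (Sum.inl ⟨i, x⟩))) (w : WedgeSum pt) :
    p w := by
  obtain ⟨(⟨i, x⟩ | ⟨⟩), rfl⟩ := Quot.exists_rep w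
  exacts [h i x, hb]

namespace PreAbstractSimplicialComplex

open UnreducedSuspension (base apex slide slide_neg_one slide_of_le slide_of_ge continuous_slide
  continuous_mk mk_eq_base mk_eq_apex)

/-! ### Points of realizations and suspended inclusions -/

section Realization

variable {V : Type*}

theorem suspIncl_mem_range {A B C : PreAbstractSimplicialComplex V} (hAB : A ≤ B) (hBC : B ≤ C)
    (x : UnreducedSuspension A.realization) :
    suspIncl (hAB.trans hBC) x ∈ Set.range (suspIncl hBC) := by
  refine ⟨suspIncl hAB x, ?_⟩
  induction x using UnreducedSuspension.ind <;> rfl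

theorem suspIncl_suspIncl {A B C : PreAbstractSimplicialComplex V} (hAB : A ≤ B) (hBC : B ≤ C)
    (x : UnreducedSuspension A.realization) :
    suspIncl hBC (suspIncl hAB x) = suspIncl (hAB.trans hBC) x := by
  induction x using UnreducedSuspension.ind <;> rfl

theorem range_suspIncl_mono {A B C : PreAbstractSimplicialComplex V} (hAB : A ≤ B) (hBC : B ≤ C) :
    Set.range (suspIncl (hAB.trans hBC)) ⊆ Set.range (suspIncl hBC) := by
  rintro _ ⟨x, rfl⟩
  exact suspIncl_mem_range hAB hBC x

theorem base_mem_range_suspIncl {A B : PreAbstractSimplicialComplex V} (hAB : A ≤ B) :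
    base B.realization ∈ Set.range (suspIncl hAB) :=
  ⟨base _, rfl⟩

variable [DecidableEq V]

theorem single_mem_realization {A : PreAbstractSimplicialComplex V} {v : V}
    (hv : {v} ∈ A.faces) : (Pi.single v 1 : V → ℝ) ∈ A.realization := by
  refine ⟨fun i => ?_, {v}, hv, fun i hi => ?_, by simp⟩
  · by_cases h : i = v
    · subst h; simp
    · simp [h]
  · simp [Finset.mem_singleton.not.1 hi]

theorem segment_mem_realization {A B : PreAbstractSimplicialComplex V} {v : V}
    (hAB : ∀ σ ∈ A.faces, insert v σ ∈ B.faces) {y : V → ℝ} (hy : y ∈ A.realization)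
    (r : Set.Icc (0 : ℝ) 1) :
    (1 - (r : ℝ)) • y + (r : ℝ) • Pi.single v (1 : ℝ) ∈ B.realization := by
  obtain ⟨h0, σ, hσ, hz, hs⟩ := hy
  refine ⟨fun i => ?_, insert v σ, hAB σ hσ, fun i hi => ?_, ?_⟩
  · have h1 : (0 : ℝ) ≤ (Pi.single v 1 : V → ℝ) i := by
      by_cases h : i = v
      · subst h; simp
      · simp [h]
    have := mul_nonneg (sub_nonneg.2 r.2.2) (h0 i)
    have := mul_nonneg r.2.1 h1
    simp only [Pi.add_apply, Pi.smul_apply, smul_eq_mul]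
    linarith
  · rw [Finset.mem_insert, not_or] at hi
    simp [hz i hi.2, hi.1]
  · have h1 : ∑ i ∈ insert v σ, y i = 1 := by
      rw [← hs]
      exact (Finset.sum_subset (Finset.subset_insert v σ) fun i _ hi => hz i hi).symm
    have h2 : ∑ i ∈ insert v σ, (Pi.single v 1 : V → ℝ) i = 1 := by
      rw [Finset.sum_pi_single']
      simp
    simp only [Pi.add_apply, Pi.smul_apply, smul_eq_mul, Finset.sum_add_distrib, ← Finset.mul_sum,
      h1, h2]
    ring

end Realization

/-! ### Contracting the suspended simplex through a vertex -/

section ConePush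

variable {V : Type*} {I : Finset V} {v : V}

theorem singleton_mem_fullSimplex (hv : v ∈ I) : {v} ∈ (fullSimplex I).faces :=
  ⟨Finset.singleton_nonempty v, Finset.singleton_subset_iff.2 hv⟩

variable [DecidableEq V]

theorem insert_mem_fullSimplex (hv : v ∈ I) {σ : Finset V} (hσ : σ ∈ (fullSimplex I).faces) :
    insert v σ ∈ (fullSimplex I).faces :=
  ⟨Finset.insert_nonempty _ _, Finset.insert_subset hv hσ.2⟩

/-- The linear contraction of the simplex `|Δ^I|` to its vertex `v`, with time cut off to
`[0, 1]`. -/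
noncomputable def toVertex (hv : v ∈ I) (d : ℝ) (y : (fullSimplex I).realization) :
    (fullSimplex I).realization :=
  ⟨_, segment_mem_realization (fun _ => insert_mem_fullSimplex hv) y.2
    (Set.projIcc 0 1 zero_le_one d)⟩

theorem continuous_toVertex (hv : v ∈ I) :
    Continuous fun p : ℝ × (fullSimplex I).realization => toVertex hv p.1 p.2 := by
  have : Continuous fun p : ℝ × (fullSimplex I).realization =>
      ((Set.projIcc (0 : ℝ) 1 zero_le_one p.1 : Set.Icc (0 : ℝ) 1) : ℝ) :=
    continuous_subtype_val.comp (continuous_projIcc.comp continuous_fst)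
  refine Continuous.subtype_mk ?_ _
  fun_prop

theorem toVertex_zero (hv : v ∈ I) (y : (fullSimplex I).realization) : toVertex hv 0 y = y := by
  apply Subtype.ext
  simp [toVertex]

theorem toVertex_of_ge (hv : v ∈ I) {d : ℝ} (hd : 1 ≤ d) (y : (fullSimplex I).realization) :
    toVertex hv d y = ⟨_, single_mem_realization (singleton_mem_fullSimplex hv)⟩ := by
  apply Subtype.ext
  simp [toVertex, Set.projIcc_of_right_le _ hd]

/-- The null-homotopy of `Σ|Δ^I|` through the vertex `v`, on the time interval `[0, 3]`: first
`|Δ^I|` is contracted to `v`, and then the suspension `Σ{v}` of the vertex is contracted to the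
basepoint. -/
noncomputable def conePush (hv : v ∈ I) :
    C(UnreducedSuspension (fullSimplex I).realization × ℝ,
      UnreducedSuspension (fullSimplex I).realization) :=
  ContinuousMap.uncurry <| UnreducedSuspension.desc
    (ContinuousMap.curry
      ⟨fun p : (D1 × (fullSimplex I).realization) × ℝ =>
          UnreducedSuspension.mk (slide p.2 p.1.1) (toVertex hv p.2 p.1.2),
        continuous_mk.comp
          ((continuous_slide.comp (continuous_snd.prodMk (continuous_fst.comp continuous_fst))).prodMk
            ((continuous_toVertex hv).comp
              (continuous_snd.prodMk (continuous_snd.comp continuous_fst))))⟩)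
    (ContinuousMap.const _ (base _))
    ⟨fun d => UnreducedSuspension.mk (slide d ⟨1, by norm_num⟩)
        ⟨_, single_mem_realization (singleton_mem_fullSimplex hv)⟩,
      by
        exact continuous_mk.comp
          ((continuous_slide.comp (continuous_id.prodMk continuous_const)).prodMk
            continuous_const)⟩
    (by
      intro s y hs
      ext d
      exact mk_eq_base (slide_neg_one d hs) _)
    (by
      intro s y hs
      ext d
      obtain rfl : s = ⟨1, by norm_num⟩ := Subtype.ext hs
      rcases le_total d 1 with hd | hd
      -- Until time `1` the suspension coordinate is `1`, so both points are the cone point.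
      · exact (mk_eq_apex (by rw [slide_of_le hd]) _).trans
          (mk_eq_apex (by rw [slide_of_le hd]) _).symm
      · change UnreducedSuspension.mk _ (toVertex hv d y) = UnreducedSuspension.mk _ _
        rw [toVertex_of_ge hv hd])

theorem conePush_base (hv : v ∈ I) (d : ℝ) : conePush hv (base _, d) = base _ := rfl

theorem conePush_mk (hv : v ∈ I) (d : ℝ) (s : D1) (y : (fullSimplex I).realization) :
    conePush hv (UnreducedSuspension.mk s y, d) = UnreducedSuspension.mk (slide d s) (toVertex hv d y) :=
  rfl

theorem conePush_apex (hv : v ∈ I) (d : ℝ) :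
    conePush hv (apex _, d) = UnreducedSuspension.mk (slide d ⟨1, by norm_num⟩)
      ⟨_, single_mem_realization (singleton_mem_fullSimplex hv)⟩ := rfl

theorem conePush_zero (hv : v ∈ I) (x : UnreducedSuspension (fullSimplex I).realization) :
    conePush hv (x, 0) = x := by
  induction x using UnreducedSuspension.ind with
  | hb => rfl
  | ht => rw [conePush_apex]; exact mk_eq_apex (by rw [slide_of_le zero_le_one]) _
  | hmk s y => rw [conePush_mk, slide_of_le zero_le_one, toVertex_zero]

theorem conePush_of_ge (hv : v ∈ I) {d : ℝ} (hd : 3 ≤ d)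
    (x : UnreducedSuspension (fullSimplex I).realization) : conePush hv (x, d) = base _ := by
  induction x using UnreducedSuspension.ind with
  | hb => rfl
  | ht => exact mk_eq_base (slide_of_ge hd _) _
  | hmk s y => exact mk_eq_base (slide_of_ge hd _) _

/-- The null-homotopy through `v` maps `Σ|A|` to `Σ|B|` if `B` contains the cone over `A` with
apex `v`. -/
theorem conePush_mem_range (hv : v ∈ I) {A B : PreAbstractSimplicialComplex V}
    (hA : A ≤ fullSimplex I) (hB : B ≤ fullSimplex I) (hvB : {v} ∈ B.faces)
    (hAB : ∀ σ ∈ A.faces, insert v σ ∈ B.faces)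
    {x : UnreducedSuspension (fullSimplex I).realization} (hx : x ∈ Set.range (suspIncl hA))
    (d : ℝ) : conePush hv (x, d) ∈ Set.range (suspIncl hB) := by
  obtain ⟨x, rfl⟩ := hx
  induction x using UnreducedSuspension.ind with
  | hb => exact base_mem_range_suspIncl hB
  | ht => exact ⟨UnreducedSuspension.mk (slide d ⟨1, by norm_num⟩) ⟨_, single_mem_realization hvB⟩, rfl⟩
  | hmk s y => exact ⟨UnreducedSuspension.mk (slide d s) ⟨_, segment_mem_realization hAB y.2 _⟩, rfl⟩

end ConePush

/-! ### Joins over level sets -/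

section LevelJoin

variable {V : Type*} [DecidableEq V] {I : Finset V}

theorem mem_restrictJoin_levelSets {L : PreAbstractSimplicialComplex V} {s : V → ℝ}
    {σ : Finset V} : σ ∈ (L.restrictJoin (levelSets I s)).faces ↔
      σ.Nonempty ∧ σ ⊆ I ∧ ∀ i ∈ σ, σ.filter (fun j => s j = s i) ∈ L.faces := by
  have key : ∀ c, σ ⊆ I → σ ∩ I.filter (fun i => s i = c) = σ.filter (fun j => s j = c) := by
    intro c h
    ext j
    simp only [Finset.mem_inter, Finset.mem_filter]
    exact ⟨fun hj => ⟨hj.1, hj.2.2⟩, fun hj => ⟨hj.1, h hj.1, hj.2⟩⟩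
  constructor
  · intro h
    have hI := (restrictJoin_levelSets_le L I s h).2
    refine ⟨h.1, hI, fun i hi => ?_⟩
    rw [← key _ hI]
    refine h.2.2 _ (Finset.mem_image.2 ⟨s i, Finset.mem_image_of_mem _ (hI hi), rfl⟩) ⟨i, ?_⟩
    simp [hi, hI hi]
  · rintro ⟨hne, hI, h⟩
    refine ⟨hne, fun i hi => ?_, fun J hJ hne => ?_⟩
    · refine Finset.mem_biUnion.2 ⟨_, Finset.mem_image.2
        ⟨s i, Finset.mem_image_of_mem _ (hI hi), rfl⟩, ?_⟩
      simp [hI hi]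
    · obtain ⟨c, -, rfl⟩ := Finset.mem_image.1 hJ
      rw [key c hI] at hne ⊢
      obtain ⟨i, hi⟩ := hne
      obtain ⟨hiσ, rfl⟩ := Finset.mem_filter.1 hi
      exact h i hiσ

theorem le_restrictJoin_levelSets {L : PreAbstractSimplicialComplex V} (hL : L ≤ fullSimplex I)
    (s : V → ℝ) : L ≤ L.restrictJoin (levelSets I s) := fun σ hσ =>
  mem_restrictJoin_levelSets.2 ⟨(hL hσ).1, (hL hσ).2, fun i hi =>
    (L.isRelLowerSet_faces hσ).2 (Finset.filter_subset _ _) ⟨i, by simp [hi]⟩⟩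

/-- A finer partition gives a larger join. -/
theorem restrictJoin_levelSets_mono (L : PreAbstractSimplicialComplex V) {s s' : V → ℝ}
    (h : ∀ i j, s' i = s' j → s i = s j) :
    L.restrictJoin (levelSets I s) ≤ L.restrictJoin (levelSets I s') := by
  intro σ hσ
  obtain ⟨hne, hI, hσ⟩ := mem_restrictJoin_levelSets.1 hσ
  refine mem_restrictJoin_levelSets.2 ⟨hne, hI, fun i hi => ?_⟩
  refine (L.isRelLowerSet_faces (hσ i hi)).2 ?_ ⟨i, by simp [hi]⟩
  exact Finset.monotone_filter_right _ fun j _ hj => h j i hj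

theorem restrictJoin_deleteVertex_le (L : PreAbstractSimplicialComplex V) (v : V) (s : V → ℝ) :
    (L.deleteVertex v).restrictJoin (levelSets (I.erase v) s) ≤ L.restrictJoin (levelSets I s) := by
  intro σ hσ
  obtain ⟨hne, hI, hσ⟩ := mem_restrictJoin_levelSets.1 hσ
  exact mem_restrictJoin_levelSets.2
    ⟨hne, hI.trans (Finset.erase_subset _ _), fun i hi => (hσ i hi).1⟩

/-- If `v` is alone in its level set, then the join over `I` contains the cone with apex `v` over
the join over `I ∖ {v}`. -/
theorem insert_mem_restrictJoin_levelSets {L : PreAbstractSimplicialComplex V} {v : V}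
    (hv : v ∈ I) (hvL : {v} ∈ L.faces) {s : V → ℝ} (hs : ∀ j ∈ I.erase v, s v ≠ s j)
    {σ : Finset V}
    (hσ : σ ∈ ((L.deleteVertex v).restrictJoin (levelSets (I.erase v) s)).faces) :
    insert v σ ∈ (L.restrictJoin (levelSets I s)).faces := by
  obtain ⟨hne, hI, hσ⟩ := mem_restrictJoin_levelSets.1 hσ
  refine mem_restrictJoin_levelSets.2 ⟨Finset.insert_nonempty _ _,
    Finset.insert_subset hv (hI.trans (Finset.erase_subset _ _)), fun i hi => ?_⟩
  rcases Finset.mem_insert.1 hi with rfl | hi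
  · rw [Finset.filter_insert, if_pos rfl, Finset.filter_eq_empty_iff.2]
    · simpa using hvL
    · exact fun j hj h => hs j (hI hj) h.symm
  · rw [Finset.filter_insert, if_neg (hs i (hI hi))]
    exact (hσ i hi).1

/-- If `L ∖ {i}` is a full simplex, then the join only constrains the level set of `i`, so that any
vertex outside of this level set may be added to a face. -/
theorem insert_mem_restrictJoin_levelSets_of_simplex {L : PreAbstractSimplicialComplex V} {i v : V}
    (hL : L.deleteVertex i = fullSimplex (I.erase i)) (hv : v ∈ I) {s : V → ℝ}
    (hs : s v ≠ s i) {σ : Finset V} (hσ : σ ∈ (L.restrictJoin (levelSets I s)).faces) :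
    insert v σ ∈ (L.restrictJoin (levelSets I s)).faces := by
  obtain ⟨hne, hI, hσ⟩ := mem_restrictJoin_levelSets.1 hσ
  have hI' := Finset.insert_subset hv hI
  refine mem_restrictJoin_levelSets.2 ⟨Finset.insert_nonempty _ _, hI', fun j hj => ?_⟩
  by_cases hji : i ∈ (insert v σ).filter (fun k => s k = s j)
  · obtain ⟨hi, hij⟩ := Finset.mem_filter.1 hji
    have hvj : s v ≠ s j := fun h => hs (h.trans hij.symm)
    rw [Finset.filter_insert, if_neg hvj]
    refine hσ j ((Finset.mem_insert.1 hj).resolve_left ?_)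
    rintro rfl
    exact hvj rfl
  · have : (insert v σ).filter (fun k => s k = s j) ∈ (L.deleteVertex i).faces := by
      rw [hL]
      refine ⟨⟨j, by simpa using hj⟩, fun k hk => Finset.mem_erase.2 ⟨?_, ?_⟩⟩
      · rintro rfl
        exact hji hk
      · exact hI' (Finset.mem_filter.1 hk).1
    exact this.1

end LevelJoin

/-! ### Coherent contractions -/

section Contraction

theorem HasVertexSet.deleteVertex {V : Type*} [DecidableEq V] {I : Finset V}
    {K : PreAbstractSimplicialComplex V}
    (h : K.HasVertexSet I) (i : V) : (K.deleteVertex i).HasVertexSet (I.erase i) := by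
  intro j
  rw [Finset.mem_erase, ← h j, and_comm]
  simp [PreAbstractSimplicialComplex.deleteVertex, eq_comm]

universe u

variable {V : Type u} {T : Type u} [DecidableEq V] [TopologicalSpace T]

/-- A null-homotopy `Φ` of `Σ|K|` in `Σ|Δ^I|` whose parameter space `T` carries a family `τ` of
real numbers indexed by the vertices. Its constraint at time `t` is expressed by the differences of
the numbers `τ t i`, `i ∈ I`: if all vanish then `Φ` is the inclusion, if one of them is at least
`1` then `Φ` is constant, and always `Φ` lands in the suspended join of the restrictions of `K` to
the level sets. No vertex is distinguished here, in contrast to `IsGolodMap`. -/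
structure IsCoherentContraction (I : Finset V) (K : PreAbstractSimplicialComplex V)
    (hK : K ≤ fullSimplex I) (τ : T → V → ℝ)
    (Φ : C(UnreducedSuspension K.realization × T, UnreducedSuspension (fullSimplex I).realization)) :
    Prop where
  map_base : ∀ t, Φ (base _, t) = base _
  of_const : ∀ t, (∀ i ∈ I, ∀ j ∈ I, τ t i = τ t j) → ∀ x, Φ (x, t) = suspIncl hK x
  of_spread : ∀ t, (∃ i ∈ I, ∃ j ∈ I, 1 ≤ |τ t i - τ t j|) → ∀ x, Φ (x, t) = base _
  mem_join : ∀ t x, Φ (x, t) ∈ Set.range (suspIncl (restrictJoin_levelSets_le K I (τ t)))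

/-- The complex `K` on `I` admits coherent contractions for all parameter spaces. Locally compact
spaces are used so that maps out of quotients times `T` can be defined by currying. -/
def CoherentlyContractible (I : Finset V) (K : PreAbstractSimplicialComplex V)
    (hK : K ≤ fullSimplex I) : Prop :=
  ∀ (T : Type u) [TopologicalSpace T] [LocallyCompactSpace T] (τ : T → V → ℝ), Continuous τ →
    ∃ Φ : C(UnreducedSuspension K.realization × T, UnreducedSuspension (fullSimplex I).realization),
      IsCoherentContraction I K hK τ Φ

/-- If `K ∖ {i}` is a full simplex, then one may push successively towards the vertices `j ∈ S`,
each for a time proportional to `|τ_j - τ_i|`, without leaving the joins. -/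
theorem exists_iterated_conePush {I : Finset V} {K : PreAbstractSimplicialComplex V}
    (hK : K.HasVertexSet I) {i : V}
    (hi : K.deleteVertex i = fullSimplex (I.erase i)) {τ : T → V → ℝ} (hτ : Continuous τ)
    (S : Finset V) (hS : S ⊆ I) :
    ∃ F : C(UnreducedSuspension (fullSimplex I).realization × T,
        UnreducedSuspension (fullSimplex I).realization),
      (∀ t, F (base _, t) = base _) ∧
      (∀ t, (∀ j ∈ S, τ t j = τ t i) → ∀ x, F (x, t) = x) ∧
      (∀ t, (∃ j ∈ S, 1 / 2 ≤ |τ t j - τ t i|) → ∀ x, F (x, t) = base _) ∧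
      ∀ t, ∀ x ∈ Set.range (suspIncl (restrictJoin_levelSets_le K I (τ t))),
        F (x, t) ∈ Set.range (suspIncl (restrictJoin_levelSets_le K I (τ t))) := by
  induction S using Finset.induction_on with
  | empty => exact ⟨ContinuousMap.fst, by simp, by simp, by simp, fun _ _ h => h⟩
  | insert j S _ ih =>
    obtain ⟨F, hb, hc, hs, hm⟩ := ih fun k hk => hS (Finset.mem_insert_of_mem hk)
    have hj : j ∈ I := hS (Finset.mem_insert_self j S)
    -- The factor `6` completes the push, of length `3`, once `|τ_j - τ_i| ≥ 1 / 2`.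
    let F' := (conePush hj).comp (F.prodMk ⟨fun p => 6 * |τ p.2 j - τ p.2 i|, by fun_prop⟩)
    have hF' : ∀ x t, F' (x, t) = conePush hj (F (x, t), 6 * |τ t j - τ t i|) := fun _ _ => rfl
    refine ⟨F', fun t => ?_, fun t ht x => ?_, fun t ht x => ?_, fun t x hx => ?_⟩
    all_goals rw [hF']
    · rw [hb, conePush_base]
    · rw [hc t (fun k hk => ht k (Finset.mem_insert_of_mem hk)), ht j (Finset.mem_insert_self j S),
        sub_self, abs_zero, mul_zero, conePush_zero]
    · obtain ⟨k, hk, hkt⟩ := ht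
      rcases Finset.mem_insert.1 hk with rfl | hk
      · exact conePush_of_ge hj (by linarith) _
      · rw [hs t ⟨k, hk, hkt⟩, conePush_base]
    · by_cases h : τ t j = τ t i
      · rw [h, sub_self, abs_zero, mul_zero, conePush_zero]
        exact hm t x hx
      · exact conePush_mem_range hj _ _
          (le_restrictJoin_levelSets hK.le_fullSimplex _ ((hK j).2 hj))
          (fun σ hσ => insert_mem_restrictJoin_levelSets_of_simplex hi hj h hσ) (hm t x hx) _

theorem CoherentlyContractible.of_simplex {I : Finset V} {K : PreAbstractSimplicialComplex V}
    (hK : K.HasVertexSet I) {i : V} (hiI : i ∈ I)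
    (hi : K.deleteVertex i = fullSimplex (I.erase i)) :
    CoherentlyContractible I K hK.le_fullSimplex := by
  intro T _ _ τ hτ
  obtain ⟨F, hb, hc, hs, hm⟩ := exists_iterated_conePush hK hi hτ (I.erase i) (I.erase_subset i)
  refine ⟨F.comp ((suspIncl hK.le_fullSimplex).prodMap (ContinuousMap.id T)), hb,
    fun t ht x => ?_, fun t ht x => ?_, fun t x => ?_⟩
  · exact hc t (fun j hj => ht j (Finset.mem_of_mem_erase hj) i hiI) _
  · obtain ⟨a, ha, b, hb, hab⟩ := ht
    refine hs t ?_ _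
    -- One of `τ_a`, `τ_b` has distance at least `1 / 2` from `τ_i`.
    by_contra! h
    have key : ∀ j ∈ I, |τ t j - τ t i| < 1 / 2 := fun j hj => by
      by_cases hji : j = i
      · rw [hji, sub_self, abs_zero]
        norm_num
      · exact h j (Finset.mem_erase.2 ⟨hji, hj⟩)
    have h1 := key a ha
    have h2 := key b hb
    have h3 := abs_sub_le (τ t a) (τ t i) (τ t b)
    rw [abs_sub_comm (τ t i)] at h3
    linarith
  · exact hm t _ (suspIncl_mem_range (le_restrictJoin_levelSets hK.le_fullSimplex _) _ x)

/-- The coherent contractions of the deletions `K ∖ {i}`, followed by pushing towards `i` for a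
time that vanishes unless `i` is alone in its level set, assemble to a contraction of the wedge. -/
theorem exists_deletionWedge_contraction [LocallyCompactSpace T] {I : Finset V}
    {K : PreAbstractSimplicialComplex V} (hK : K.HasVertexSet I)
    (hdel : ∀ i ∈ I, CoherentlyContractible (I.erase i) (K.deleteVertex i)
      (hK.deleteVertex i).le_fullSimplex) {τ : T → V → ℝ} (hτ : Continuous τ) :
    ∃ G : C(K.DeletionWedge I × T, UnreducedSuspension (fullSimplex I).realization),
      (∀ t, G (WedgeSum.base _, t) = base _) ∧
      (∀ t, I.Nontrivial → (∀ i ∈ I, ∀ j ∈ I, τ t i = τ t j) →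
        ∀ w, G (w, t) = suspIncl hK.le_fullSimplex (K.deletionWedgeMap I w)) ∧
      (∀ t, (∃ i ∈ I, ∃ j ∈ I, 3 ≤ |τ t i - τ t j|) → ∀ w, G (w, t) = base _) ∧
      ∀ t w, G (w, t) ∈ Set.range (suspIncl (restrictJoin_levelSets_le K I (τ t))) := by
  choose Φ hΦ using fun i : I => hdel i i.2 T τ hτ
  have hle : ∀ i : V, fullSimplex (I.erase i) ≤ fullSimplex I :=
    fun i σ hσ => ⟨hσ.1, hσ.2.trans (I.erase_subset i)⟩
  -- This time vanishes if `τ_i` equals another `τ_j`, and is at least `3`, the length of the push,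
  -- if `τ_i` has distance at least `1` from all others.
  let d : I → T → ℝ := fun i t => 3 * ∏ j ∈ I.erase i, |τ t i - τ t j|
  have hd : ∀ i, Continuous (d i) := fun i => by fun_prop
  let g : ∀ i : I, C(UnreducedSuspension (K.deleteVertex (i : V)).realization × T,
      UnreducedSuspension (fullSimplex I).realization) := fun i =>
    (conePush i.2).comp (((suspIncl (hle i)).comp (Φ i)).prodMk ⟨fun p => d i p.2, by fun_prop⟩)
  have hg : ∀ i x t, g i (x, t) = conePush i.2 (suspIncl (hle i) (Φ i (x, t)), d i t) :=
    fun _ _ _ => rfl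
  have hgb : ∀ i t, g i (base _, t) = base _ := fun i t => by
    rw [hg, (hΦ i).map_base]
    exact conePush_base _ _
  let G : C(K.DeletionWedge I × T, UnreducedSuspension (fullSimplex I).realization) :=
    ContinuousMap.uncurry (WedgeSum.desc (ContinuousMap.const T (base _))
      (fun i => (g i).curry) (fun i => ContinuousMap.ext (hgb i)))
  refine ⟨G, fun t => rfl, fun t hI ht w => ?_, fun t ht w => ?_, fun t w => ?_⟩
  · induction w using WedgeSum.ind with
    | hb => rfl
    | h i x =>
      have hd0 : d i t = 0 := by
        obtain ⟨j, hj, hji⟩ := hI.exists_ne i.1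
        have : ∏ j ∈ I.erase i.1, |τ t i - τ t j| = 0 :=
          Finset.prod_eq_zero (Finset.mem_erase.2 ⟨hji, hj⟩)
            (by rw [ht i i.2 j hj, sub_self, abs_zero])
        simp only [d, this, mul_zero]
      change g i (x, t) = suspIncl _ (suspIncl (K.deleteVertex_le i) x)
      rw [hg, hd0, conePush_zero, (hΦ i).of_const t (fun a ha b hb =>
        ht a (Finset.mem_of_mem_erase ha) b (Finset.mem_of_mem_erase hb)), suspIncl_suspIncl,
        suspIncl_suspIncl]
  · induction w using WedgeSum.ind with
    | hb => rfl
    | h i x =>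
      change g i (x, t) = _
      rw [hg]
      by_cases hs : ∃ a ∈ I.erase i.1, ∃ b ∈ I.erase i.1, 1 ≤ |τ t a - τ t b|
      · rw [(hΦ i).of_spread t hs]
        exact conePush_base _ _
      · -- All numbers `τ_a`, `a ≠ i`, are within distance `1` of each other, so `τ_i` is far from
        -- all of them.
        push Not at hs
        obtain ⟨a, ha, b, hb, hab⟩ := ht
        have hfar : ∃ a ∈ I.erase i.1, 3 ≤ |τ t i - τ t a| := by
          by_cases hai : a = i.1
          · subst hai
            refine ⟨b, Finset.mem_erase.2 ⟨?_, hb⟩, hab⟩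
            rintro rfl
            norm_num at hab
          · by_cases hbi : b = i.1
            · subst hbi
              exact ⟨a, Finset.mem_erase.2 ⟨hai, ha⟩, by rwa [abs_sub_comm]⟩
            · have := hs a (Finset.mem_erase.2 ⟨hai, ha⟩) b (Finset.mem_erase.2 ⟨hbi, hb⟩)
              linarith
        obtain ⟨c, hc, hic⟩ := hfar
        refine conePush_of_ge _ ?_ _
        have : 1 ≤ ∏ j ∈ I.erase i.1, |τ t i - τ t j| := by
          rw [← Finset.prod_const_one (s := I.erase i.1)]
          refine Finset.prod_le_prod (fun _ _ => zero_le_one) fun j hj => ?_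
          have h1 := (hs c hc j hj).le
          have h2 := abs_sub_le (τ t i) (τ t j) (τ t c)
          rw [abs_sub_comm (τ t j)] at h2
          linarith
        simp only [d]
        linarith
  · induction w using WedgeSum.ind with
    | hb => exact base_mem_range_suspIncl _
    | h i x =>
      change g i (x, t) ∈ _
      rw [hg]
      have hmem : suspIncl (hle i) (Φ i (x, t)) ∈ Set.range (suspIncl
          ((restrictJoin_levelSets_le (K.deleteVertex i) (I.erase i) (τ t)).trans (hle i))) := by
        obtain ⟨y, hy⟩ := (hΦ i).mem_join t x
        exact ⟨y, by rw [← hy, suspIncl_suspIncl]⟩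
      by_cases hs : ∃ j ∈ I.erase i.1, τ t i = τ t j
      · obtain ⟨j, hj, hij⟩ := hs
        have hd0 : d i t = 0 := by
          have : ∏ j ∈ I.erase i.1, |τ t i - τ t j| = 0 :=
            Finset.prod_eq_zero hj (by rw [hij, sub_self, abs_zero])
          simp only [d, this, mul_zero]
        rw [hd0, conePush_zero]
        exact range_suspIncl_mono (restrictJoin_deleteVertex_le K i (τ t)) _ hmem
      · push Not at hs
        have hiK : {i.1} ∈ K.faces := (hK i).2 i.2
        exact conePush_mem_range i.2 _ _ (le_restrictJoin_levelSets hK.le_fullSimplex _ hiK)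
          (fun σ hσ => insert_mem_restrictJoin_levelSets i.2 hiK hs hσ) hmem _

/-- The contraction for `K` runs in two stages, separated by the value `1` of the total spread
`D = ∑ 2 |τ_i - τ_j|`: the homotopy from the identity to the section, and then the contraction of
the wedge for a rescaling of `τ` that vanishes at `D = 1`. -/
theorem CoherentlyContractible.of_section {I : Finset V} {K : PreAbstractSimplicialComplex V}
    (hK : K.HasVertexSet I)
    (hdel : ∀ i ∈ I, CoherentlyContractible (I.erase i) (K.deleteVertex i)
      (hK.deleteVertex i).le_fullSimplex)
    (s : C(UnreducedSuspension K.realization, K.DeletionWedge I)) (hs : s (base _) = WedgeSum.base _)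
    (hH : ((K.deletionWedgeMap I).comp s).HomotopicRel (ContinuousMap.id _) {base _}) :
    CoherentlyContractible I K hK.le_fullSimplex := by
  intro T _ _ τ hτ
  obtain ⟨H⟩ := hH.symm
  let D : T → ℝ := fun t => ∑ i ∈ I, ∑ j ∈ I, 2 * |τ t i - τ t j|
  have hD : Continuous D := by fun_prop
  have hDle : ∀ t, ∀ i ∈ I, ∀ j ∈ I, 2 * |τ t i - τ t j| ≤ D t := fun t i hi j hj =>
    (Finset.single_le_sum (f := fun j => 2 * |τ t i - τ t j|) (fun _ _ => by positivity) hj).trans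
      (Finset.single_le_sum (f := fun i => ∑ j ∈ I, 2 * |τ t i - τ t j|)
        (fun _ _ => by positivity) hi)
  have hD0 : ∀ t, (∀ i ∈ I, ∀ j ∈ I, τ t i = τ t j) → D t = 0 := fun t ht =>
    Finset.sum_eq_zero fun i hi => Finset.sum_eq_zero fun j hj => by rw [ht i hi j hj]; simp
  obtain ⟨G, hGb, hGc, hGs, hGm⟩ := exists_deletionWedge_contraction hK hdel
    (τ := fun t v => max 0 (D t - 1) * (3 * τ t v)) (by fun_prop)
  -- The factor `2` in `D` and the factor `3` make the rescaled family have spread at least `3`, as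
  -- the contraction of the wedge needs, as soon as `τ` has spread at least `1`.
  have hcont : Continuous fun p : UnreducedSuspension K.realization × T =>
      if D p.2 ≤ 1 then suspIncl hK.le_fullSimplex (H (Set.projIcc 0 1 zero_le_one (D p.2), p.1))
      else G (s p.1, p.2) := by
    refine Continuous.if_le ?_ ?_ (hD.comp continuous_snd) continuous_const fun p hp => ?_
    · exact (suspIncl hK.le_fullSimplex).continuous.comp (H.continuous.comp
        ((continuous_projIcc.comp (hD.comp continuous_snd)).prodMk continuous_fst))
    · exact G.continuous.comp ((s.continuous.comp continuous_fst).prodMk continuous_snd)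
    · -- At `D = 1` the rescaled family is zero, and `I` has two elements because `D ≠ 0`.
      rw [hGc, hp, Set.projIcc_right]
      · exact congrArg _ (H.apply_one p.1)
      · by_contra hI
        rw [hD0] at hp
        · exact zero_ne_one hp
        · intro i hi j hj
          by_contra hij
          exact hI ⟨i, hi, j, hj, fun h => hij (by rw [h])⟩
      · simp [hp]
  refine ⟨⟨_, hcont⟩, fun t => ?_, fun t ht x => ?_, fun t ht x => ?_, fun t x => ?_⟩
  all_goals simp only [ContinuousMap.coe_mk]
  · rw [hs, hGb]
    split_ifs
    · rw [H.eq_fst _ rfl]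
      rfl
    · rfl
  · rw [hD0 t ht, if_pos zero_le_one, Set.projIcc_left]
    exact congrArg _ (H.apply_zero x)
  · obtain ⟨i, hi, j, hj, hij⟩ := ht
    have h2 : 2 ≤ D t := by linarith [hDle t i hi j hj]
    rw [if_neg (by linarith), hGs]
    refine ⟨i, hi, j, hj, ?_⟩
    rw [max_eq_right (by linarith), ← mul_sub, ← mul_sub, abs_mul, abs_mul,
      abs_of_nonneg (by linarith), abs_of_pos three_pos]
    nlinarith
  · split_ifs with h
    · exact suspIncl_mem_range (le_restrictJoin_levelSets hK.le_fullSimplex _) _ _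
    · -- The rescaled family is constant on the level sets of `τ`.
      refine range_suspIncl_mono (restrictJoin_levelSets_mono K fun i j hij => ?_) _ (hGm t (s x))
      simp only [hij]

theorem Extractible.coherentlyContractible {I : Finset V} {K : PreAbstractSimplicialComplex V}
    (h : K.Extractible I) (hK : K.HasVertexSet I) :
    CoherentlyContractible I K hK.le_fullSimplex := by
  induction h with
  | simplex I K i hiI hi => exact .of_simplex hK hiI hi
  | step I K _ hs ih =>
    obtain ⟨s, hs, hH⟩ := hs
    exact .of_section hK (fun i hi => ih i hi (hK.deleteVertex i)) s hs hH

end Contraction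

/-! ### Golod maps and the recursion over deletions -/

section Golod

variable {V : Type*} [DecidableEq V]

theorem continuous_extendZero (J : Finset V) :
    Continuous (extendZero : ({v // v ∈ J} → D1) → V → ℝ) := by
  refine continuous_pi fun v => ?_
  by_cases h : v ∈ J
  · simp only [extendZero, dif_pos h]
    fun_prop
  · simp only [extendZero, dif_neg h]
    fun_prop

theorem CoherentlyContractible.exists_isGolodMap {I : Finset V}
    {K : PreAbstractSimplicialComplex V} {hK : K ≤ fullSimplex I}
    (h : CoherentlyContractible I K hK) {e : V} (he : e ∈ I) :
    ∃ Ψ : C(IterSusp (I.erase e) K, UnreducedSuspension (fullSimplex I).realization),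
      IsGolodMap I K K hK e Ψ := by
  obtain ⟨Φ, hΦ⟩ := h _ _ (continuous_extendZero (I.erase e))
  have he0 : ∀ t : {v // v ∈ I.erase e} → D1, extendZero t e = 0 := fun t =>
    dif_neg (Finset.notMem_erase e I)
  have hcol : ∀ p ∈ collapsed (I.erase e) K, Φ (p.2, p.1) = base _ := by
    rintro ⟨t, x⟩ (⟨j, hj⟩ | hx)
    · refine hΦ.of_spread t ⟨j, Finset.mem_of_mem_erase j.2, e, he, ?_⟩ x
      have hj' : extendZero t j = t j := dif_pos j.2
      rw [he0, sub_zero, hj']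
      rcases hj with hj | hj <;> dsimp only at hj <;> rw [hj] <;> norm_num
    · change Φ (x, t) = _
      rw [show x = base _ from hx]
      exact hΦ.map_base t
  refine ⟨⟨Quot.lift (fun p => Φ (p.2, p.1)) fun p q hpq => (hcol p hpq.1).trans
    (hcol q hpq.2).symm, continuous_quot_lift _ (Φ.continuous.comp continuous_swap)⟩,
    hΦ.map_base _, fun x => hΦ.of_const _ (fun i _ j _ => ?_) x, fun t _ x => hΦ.mem_join t x⟩
  simp [extendZero, cubeZero]

theorem deleteVertex_comm {V : Type*} (K : PreAbstractSimplicialComplex V) (i j : V) :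
    (K.deleteVertex i).deleteVertex j = (K.deleteVertex j).deleteVertex i :=
  PreAbstractSimplicialComplex.ext (Set.ext fun _ => and_right_comm)

theorem fullSimplex_deleteVertex (I : Finset V) (i : V) :
    (fullSimplex I).deleteVertex i = fullSimplex (I.erase i) :=
  PreAbstractSimplicialComplex.ext (Set.ext fun _ =>
    and_assoc.trans (and_congr_right fun _ => Finset.subset_erase.symm))

theorem Extractible.deleteVertex {I : Finset V} {K : PreAbstractSimplicialComplex V}
    (h : K.Extractible I) (hI : I.Nontrivial) {i : V} (hi : i ∈ I) :
    (K.deleteVertex i).Extractible (I.erase i) := by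
  cases h with
  | step _ _ hdel _ => exact hdel i hi
  | simplex _ _ j hj h =>
    by_cases hij : i = j
    · obtain ⟨k, hk, hkj⟩ := hI.exists_ne j
      rw [hij, h]
      exact .simplex _ _ k (Finset.mem_erase.2 ⟨hkj, hk⟩) (fullSimplex_deleteVertex _ k)
    · refine .simplex _ _ j (Finset.mem_erase.2 ⟨Ne.symm hij, hj⟩) ?_
      rw [deleteVertex_comm, h, fullSimplex_deleteVertex, Finset.erase_right_comm]

theorem CoherentlyHomotopyGolod.of_extractible {I : Finset V} {K : PreAbstractSimplicialComplex V}
    (h : K.Extractible I) (hK : K.HasVertexSet I) : K.CoherentlyHomotopyGolod I := by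
  induction I using Finset.strongInduction generalizing K with
  | H I ih =>
    rcases I.eq_empty_or_nonempty with rfl | ⟨e, he⟩
    · obtain rfl : K = ⊥ := le_bot_iff.1 fun σ hσ =>
        (Finset.not_nonempty_empty ((hK.le_fullSimplex hσ).1.mono (hK.le_fullSimplex hσ).2)).elim
      exact .empty ∅ ⊥ hK
    · by_cases hI : I.Nontrivial
      · exact .step I K K hK le_rfl
          (fun i hi => ih _ (Finset.erase_ssubset hi) (h.deleteVertex hI hi) (hK.deleteVertex i))
          ⟨e, he, (h.coherentlyContractible hK).exists_isGolodMap he⟩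
      · obtain rfl : I = {e} := Finset.eq_singleton_iff_unique_mem.2
          ⟨he, fun j hj => by_contra fun h => hI ⟨j, hj, e, he, h⟩⟩
        exact .vertex e K K hK le_rfl

end Golod

end PreAbstractSimplicialComplex

theorem mainTheorem9 {V : Type*} [DecidableEq V] (I : Finset V)
    (K : PreAbstractSimplicialComplex V) (hK : K.HasVertexSet I)
    (hext : K.Extractible I) :
    K.CoherentlyHomotopyGolod I :=
  .of_extractible hext hK
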